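/- Let $n\ge 1$ and let $G$ be an abelian subgroup of $\mathrm{GL}(n,\mathbb{R})$, acting on $\mathbb{R}^n$ by $(A,v)\mapsto Av$. Suppose that $G$ is generated by $p$ matrices with $p\le\left[\frac{n+1}{2}\right]$, where $[\ ]$ denotes the integer part. Then every orbit $G(v)=\{Av : A\in G\}$, $v\in\mathbb{R}^n$, is nowhere dense in $\mathbb{R}^n$, i.e. its closure has empty interior (so $G$ has no somewhere dense orbit). In particular, $G$ is not topologically transitive, i.e. there is no $v\in\mathbb{R}^n$ for which $G(v)$ is dense in $\mathbb{R}^n$. -/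

import Mathlib

open Matrix

/-- The orbit `G(v) = {A v : A ∈ G}` of a vector `v ∈ ℝⁿ` under the linear action of a subgroup
`G` of `GL(n, ℝ)`. -/
def linearOrbit {n : ℕ} (G : Subgroup (GL (Fin n) ℝ)) (v : Fin n → ℝ) : Set (Fin n → ℝ) :=
  {w | ∃ A ∈ G, (A : Matrix (Fin n) (Fin n) ℝ) *ᵥ v = w}

/-- A subgroup `G` of `GL(n, ℝ)` is topologically transitive if some orbit of its linear action
is dense in `ℝⁿ`. -/
def IsTopologicallyTransitiveGL {n : ℕ} (G : Subgroup (GL (Fin n) ℝ)) : Prop :=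
  ∃ v : Fin n → ℝ, Dense (linearOrbit G v)

/-! Let S be the commutative real algebra generated by G. If evaluation at v is not onto, the orbit
lies in a proper subspace. Otherwise evaluation identifies S with ℝⁿ and the orbit with G inside the
units of S. As exp is open and a homomorphism, it suffices that H = exp⁻¹(G) is nowhere dense. Its
rank is at most p + rank(ker exp), and ker exp embeds in ℤ^c, c the number of complex residue
fields, with 2c ≤ n. So rank H ≤ ⌊(n+1)/2⌋ + ⌊n/2⌋ = n: H is a lattice or lies in a proper subspace.
-/

/-- A finitely generated subgroup of a nontrivial real vector space, of rank at most the dimension,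
is nowhere dense. -/
theorem isNowhereDense_of_finrank_int_le {E : Type*} [NormedAddCommGroup E] [NormedSpace ℝ E]
    [FiniteDimensional ℝ E] [Nontrivial E] (H : Submodule ℤ E) [Module.Finite ℤ H]
    (hH : Module.finrank ℤ H ≤ Module.finrank ℝ E) : IsNowhereDense (H : Set E) := by
  have : IsAddTorsionFree E := Module.isTorsionFree_int_iff_isAddTorsionFree.mp
    (Module.IsTorsionFree.trans_faithfulSMul ℤ ℝ E)
  let b := Module.finBasis ℤ H
  let v : Fin (Module.finrank ℤ H) → E := fun i => b i
  have hv : Submodule.span ℤ (Set.range v) = H := by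
    have h1 : Set.range v = H.subtype '' Set.range b := by
      rw [← Set.range_comp]; rfl
    rw [h1, ← Submodule.map_span, b.span_eq, Submodule.map_top, Submodule.range_subtype]
  have hsub : (H : Set E) ⊆ Submodule.span ℝ (Set.range v) := by
    conv_lhs => rw [← hv]
    exact Submodule.span_le_restrictScalars ℤ ℝ _
  by_cases htop : Submodule.span ℝ (Set.range v) = ⊤
  · have hcard : Module.finrank ℤ H = Module.finrank ℝ E := by
      refine le_antisymm hH ?_
      have := finrank_range_le_card (R := ℝ) v
      rwa [Set.finrank, htop, finrank_top, Fintype.card_fin] at this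
    let B : Module.Basis _ ℝ E := basisOfTopLeSpanOfCardEqFinrank v htop.ge
      (by rw [Fintype.card_fin, hcard])
    have hB : Submodule.span ℤ (Set.range B) = H := by
      rw [coe_basisOfTopLeSpanOfCardEqFinrank, hv]
    have hd : DiscreteTopology H.toAddSubgroup := by
      rw [← hB]; infer_instance
    have hc : IsClosed (H : Set E) := AddSubgroup.isClosed_of_discrete (H := H.toAddSubgroup)
    rw [hc.isNowhereDense_iff, interior_eq_empty_iff_dense_compl]
    have : Countable H := b.equivFun.injective.countable
    exact Set.Countable.dense_compl ℝ (Set.to_countable _)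
  · refine IsNowhereDense.mono hsub ?_
    rw [(Submodule.closed_of_finiteDimensional _).isNowhereDense_iff]
    by_contra h
    exact htop (Submodule.eq_top_of_nonempty_interior' _ (Set.nonempty_iff_ne_empty.mpr h))

/-- A nilpotent element with trivial exponential vanishes. -/
theorem IsNilpotent.eq_zero_of_exp_eq_one {R : Type*} [CommRing R] [Algebra ℝ R]
    [TopologicalSpace R] [IsTopologicalRing R] [T2Space R] {x : R} (hx : IsNilpotent x)
    (h : NormedSpace.exp x = 1) : x = 0 := by
  obtain ⟨k, hk⟩ := hx
  have hk' : ∀ m, k ≤ m → x ^ m = 0 := fun m hm => pow_eq_zero_of_le hm hk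
  have hs : NormedSpace.exp x =
      ∑ m ∈ Finset.range (k + 2), ((m.factorial : ℝ)⁻¹) • x ^ m := by
    rw [NormedSpace.exp_eq_tsum ℝ]
    refine tsum_eq_sum fun m hm => ?_
    rw [hk' m (by simp at hm; omega), smul_zero]
  -- Splitting off degrees 0 and 1 leaves x(1 + xc) = 0, whose second factor is a unit.
  rw [h, Finset.sum_range_succ', Finset.sum_range_succ'] at hs
  set c := ∑ m ∈ Finset.range k, (((m + 1 + 1).factorial : ℝ)⁻¹) • x ^ m with hc
  have hs2 : x * (1 + x * c) = 0 := by
    have : ∑ m ∈ Finset.range k, (((m + 1 + 1).factorial : ℝ)⁻¹) • x ^ (m + 1 + 1)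
        = x * (x * c) := by
      rw [hc, Finset.mul_sum, Finset.mul_sum]
      refine Finset.sum_congr rfl fun m _ => ?_
      rw [mul_smul_comm, mul_smul_comm, pow_succ', pow_succ']
    rw [this] at hs
    simp at hs
    linear_combination hs
  have hu : IsUnit (1 + x * c) := by
    refine IsNilpotent.isUnit_one_add ?_
    exact (Commute.all x c).isNilpotent_mul_right ⟨k, hk⟩
  exact (hu.mul_left_eq_zero).mp hs2

/-! ### Complex characters and the kernel of exp -/

/-- The complex character of a commutative finite-dimensional real algebra attached to a maximal
ideal. -/
noncomputable def maximalCharacter {R : Type*} [CommRing R] [Algebra ℝ R] [FiniteDimensional ℝ R]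
    (m : MaximalSpectrum R) : R →ₐ[ℝ] ℂ :=
  letI := Ideal.Quotient.field m.asIdeal
  (IsAlgClosed.lift (R := ℝ) (M := ℂ) (S := R ⧸ m.asIdeal)).comp (Ideal.Quotient.mkₐ ℝ m.asIdeal)

theorem maximalCharacter_eq_zero_iff {R : Type*} [CommRing R] [Algebra ℝ R]
    [FiniteDimensional ℝ R] (m : MaximalSpectrum R) (x : R) :
    maximalCharacter m x = 0 ↔ x ∈ m.asIdeal := by
  let := Ideal.Quotient.field m.asIdeal
  have h := map_eq_zero_iff
    (IsAlgClosed.lift (R := ℝ) (M := ℂ) (S := R ⧸ m.asIdeal)) (RingHom.injective _)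
    (x := Ideal.Quotient.mk m.asIdeal x)
  exact h.trans Ideal.Quotient.eq_zero_iff_mem

/-- The maximal ideals with complex residue field. -/
def complexPlaces (R : Type*) [CommRing R] [Algebra ℝ R] [FiniteDimensional ℝ R] :
    Set (MaximalSpectrum R) :=
  {m | ∃ x, (maximalCharacter m x).im ≠ 0}

theorem exists_maximalCharacter_eq {R : Type*} [CommRing R] [Algebra ℝ R] [FiniteDimensional ℝ R]
    {m : MaximalSpectrum R} (hm : m ∈ complexPlaces R) (z : ℂ) : ∃ x, maximalCharacter m x = z := by
  obtain ⟨y, hy⟩ := hm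
  set w := maximalCharacter m y with hw
  -- Since w is not real, 1 and w span ℂ over ℝ; these are the coordinates of z.
  refine ⟨(z.im / w.im) • y + algebraMap ℝ R (z.re - z.im / w.im * w.re), ?_⟩
  rw [map_add, map_smul, AlgHom.commutes, ← hw]
  apply Complex.ext <;> simp
  field_simp

theorem finite_maximalSpectrum_of_finiteDimensional (R : Type*) [CommRing R] [Algebra ℝ R]
    [FiniteDimensional ℝ R] : Finite (MaximalSpectrum R) :=
  have : IsArtinianRing R := IsArtinianRing.of_finite ℝ R
  inferInstance

/-- By the Chinese remainder theorem, R maps onto a product of copies of ℂ, one per complex place.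
-/
theorem two_mul_card_complexPlaces_le (R : Type*) [CommRing R] [Algebra ℝ R]
    [FiniteDimensional ℝ R] : 2 * Nat.card (complexPlaces R) ≤ Module.finrank ℝ R := by
  have := finite_maximalSpectrum_of_finiteDimensional R
  have : Fintype (complexPlaces R) := Fintype.ofFinite _
  let Φ : R →ₗ[ℝ] (complexPlaces R → ℂ) :=
    LinearMap.pi fun m => (maximalCharacter m.1).toLinearMap
  have hΦ : Function.Surjective Φ := by
    intro z
    choose y hy using fun m : complexPlaces R => exists_maximalCharacter_eq m.2 (z m)
    obtain ⟨r, hr⟩ := Ideal.pi_quotient_surjective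
      (I := fun m : complexPlaces R => m.1.asIdeal) (fun i j hij =>
        Ideal.isCoprime_of_isMaximal fun h => hij (Subtype.ext (MaximalSpectrum.ext h)))
      (fun m => Ideal.Quotient.mk _ (y m))
    refine ⟨r, funext fun m => ?_⟩
    have := (maximalCharacter_eq_zero_iff m.1 _).mpr (Ideal.Quotient.eq.mp (hr m))
    rw [map_sub, sub_eq_zero] at this
    exact this.trans (hy m)
  have h := Submodule.finrank_map_le Φ ⊤
  rw [Submodule.map_top, LinearMap.range_eq_top.mpr hΦ, finrank_top, finrank_top] at h
  rw [Module.finrank_pi_fintype] at h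
  simp only [Complex.finrank_real_complex, Finset.sum_const, smul_eq_mul] at h
  rw [Nat.card_eq_fintype_card, mul_comm]
  exact h

/-- The kernel of the exponential map of a commutative Banach algebra. -/
noncomputable def expKernel (R : Type*) [NormedCommRing R] [NormedAlgebra ℚ R] [CompleteSpace R] :
    AddSubgroup R where
  carrier := {x | NormedSpace.exp x = 1}
  zero_mem' := NormedSpace.exp_zero
  add_mem' {x y} hx hy := by
    rw [Set.mem_ofPred_eq] at *
    rw [NormedSpace.exp_add, hx, hy, one_mul]
  neg_mem' {x} hx := by
    rw [Set.mem_ofPred_eq] at *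
    have := NormedSpace.exp_add (x := x) (y := -x)
    rwa [hx, one_mul, add_neg_cancel, NormedSpace.exp_zero, eq_comm] at this

section
variable {R : Type*} [NormedCommRing R] [NormedAlgebra ℚ R] [NormedAlgebra ℝ R]
  [FiniteDimensional ℝ R] [CompleteSpace R]

theorem exists_int_of_mem_expKernel (m : MaximalSpectrum R) {x : R} (hx : x ∈ expKernel R) :
    ∃ k : ℤ, maximalCharacter m x = k * (2 * Real.pi * Complex.I) := by
  rw [← Complex.exp_eq_one_iff, Complex.exp_eq_exp_ℂ, ← NormedSpace.map_exp (maximalCharacter m)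
    (maximalCharacter m).toLinearMap.continuous_of_finiteDimensional]
  rw [show NormedSpace.exp x = 1 from hx, map_one]

/-- Send x to the integers k with value 2πik at each complex place. At real places the value is
real, hence 0. If all k vanish, x lies in every maximal ideal, so it is nilpotent, hence 0. -/
theorem exists_expKernel_embedding :
    ∃ f : expKernel R →ₗ[ℤ] (complexPlaces R → ℤ), Function.Injective f := by
  choose k hk using fun (x : expKernel R) (m : complexPlaces R) =>
    exists_int_of_mem_expKernel m.1 x.2
  have hadd : ∀ x y, k (x + y) = k x + k y := by
    intro x y
    funext m
    have h : ((k (x + y) m : ℂ)) * (2 * Real.pi * Complex.I)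
        = (k x m + k y m : ℂ) * (2 * Real.pi * Complex.I) := by
      rw [add_mul, ← hk, ← hk, ← hk, AddSubgroup.coe_add, map_add]
    exact_mod_cast mul_right_cancel₀ Complex.two_pi_I_ne_zero h
  refine ⟨(AddMonoidHom.mk' k hadd).toIntLinearMap, ?_⟩
  rw [injective_iff_map_eq_zero]
  intro x hx
  have hx' : k x = 0 := hx
  have hmem : ∀ m : MaximalSpectrum R, (x : R) ∈ m.asIdeal := by
    intro m
    rw [← maximalCharacter_eq_zero_iff]
    by_cases hm : m ∈ complexPlaces R
    · rw [hk x ⟨m, hm⟩, hx']; simp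
    · obtain ⟨j, hj⟩ := exists_int_of_mem_expKernel m x.2
      have him : (maximalCharacter m (x : R)).im = 0 := by
        by_contra h
        exact hm ⟨_, h⟩
      rw [hj] at him
      have : (j : ℝ) = 0 := by simpa [Real.pi_ne_zero] using him
      rw [hj, Int.cast_eq_zero.mp this]; simp
  have : IsArtinianRing R := IsArtinianRing.of_finite ℝ R
  have hnil : IsNilpotent (x : R) := nilpotent_iff_mem_prime.mpr fun J hJ =>
    hmem ⟨J, (IsArtinianRing.isPrime_iff_isMaximal J).mp hJ⟩
  exact Subtype.ext (hnil.eq_zero_of_exp_eq_one x.2)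

theorem finite_expKernel : Module.Finite ℤ (expKernel R) := by
  have := finite_maximalSpectrum_of_finiteDimensional R
  obtain ⟨f, hf⟩ := exists_expKernel_embedding (R := R)
  exact Module.Finite.of_injective f hf

/-- The rank of the kernel of the exponential map is at most half of the dimension. -/
theorem two_mul_finrank_expKernel_le :
    2 * Module.finrank ℤ (expKernel R) ≤ Module.finrank ℝ R := by
  have := finite_maximalSpectrum_of_finiteDimensional R
  have : Fintype (complexPlaces R) := Fintype.ofFinite _
  obtain ⟨f, hf⟩ := exists_expKernel_embedding (R := R)
  have h := LinearMap.finrank_le_finrank_of_injective hf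
  rw [Module.finrank_fintype_fun_eq_card, ← Nat.card_eq_fintype_card] at h
  have := two_mul_card_complexPlaces_le R
  omega
end

/-! ### Logarithms of finitely generated groups of units -/

section
variable {R : Type*} [NormedCommRing R] [NormedAlgebra ℚ R] [CompleteSpace R]

/-- The exponential map of a commutative Banach algebra as a homomorphism to the unit group. -/
noncomputable def expUnits (R : Type*) [NormedCommRing R] [NormedAlgebra ℚ R] [CompleteSpace R] :
    R →+ Additive Rˣ :=
  AddMonoidHom.mk' (fun x => Additive.ofMul (NormedSpace.isUnit_exp x).unit) fun x y => by
    rw [← ofMul_mul]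
    exact congrArg _ (Units.ext NormedSpace.exp_add)

theorem coe_expUnits (x : R) : ((expUnits R x).toMul : R) = NormedSpace.exp x := rfl

variable [NormedAlgebra ℝ R]

/-- The derivative at x is multiplication by the unit exp x, hence onto. -/
theorem map_nhds_exp (x : R) :
    Filter.map NormedSpace.exp (nhds x) = nhds (NormedSpace.exp x) := by
  refine (hasStrictFDerivAt_exp (𝕂 := ℝ) (x := x)).map_nhds_eq_of_surj ?_
  obtain ⟨u, hu⟩ := NormedSpace.isUnit_exp x
  rw [LinearMap.range_eq_top]
  intro y
  refine ⟨(u⁻¹ : Rˣ) * y, ?_⟩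
  simp [← hu]

variable [FiniteDimensional ℝ R]

/-- The additive group of logarithms of elements of a subgroup of the unit group parametrized by
`ℤ ^ p` has rank at most `p` plus the rank of the kernel of the exponential map. -/
theorem finite_and_finrank_comap_expUnits_le {p : ℕ} (ψ : (Fin p → ℤ) →ₗ[ℤ] Additive Rˣ) :
    Module.Finite ℤ ((LinearMap.range ψ).comap (expUnits R).toIntLinearMap) ∧
      Module.finrank ℤ ((LinearMap.range ψ).comap (expUnits R).toIntLinearMap) ≤
        p + Module.finrank ℤ (expKernel R) := by
  have := finite_expKernel (R := R)
  -- The fibre product of exp and ψ: it projects onto the group of logarithms, and its projection to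
  -- ℤ^p has kernel inside ker exp.
  let M : Submodule ℤ (R × (Fin p → ℤ)) := LinearMap.ker
    ((expUnits R).toIntLinearMap ∘ₗ LinearMap.fst ℤ R _ - ψ ∘ₗ LinearMap.snd ℤ R _)
  have hM : ∀ z : R × (Fin p → ℤ), z ∈ M ↔ expUnits R z.1 = ψ z.2 := fun z => by
    simp [M, sub_eq_zero]
  have hH : M.map (LinearMap.fst ℤ R _) =
      (LinearMap.range ψ).comap (expUnits R).toIntLinearMap := by
    ext x
    simp only [Submodule.mem_map, hM, Submodule.mem_comap, LinearMap.mem_range]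
    constructor
    · rintro ⟨z, hz, rfl⟩
      exact ⟨z.2, hz.symm⟩
    · rintro ⟨k, hk⟩
      exact ⟨(x, k), hk.symm, rfl⟩
  let q : M →ₗ[ℤ] (Fin p → ℤ) := LinearMap.snd ℤ R _ ∘ₗ M.subtype
  have hker : ∀ z : LinearMap.ker q, (z : M).1.1 ∈ expKernel R := by
    intro z
    have h1 := (hM _).mp z.1.2
    have h2 : (z : M).1.2 = 0 := z.2
    rw [h2, map_zero] at h1
    have := coe_expUnits (R := R) (z : M).1.1
    rw [h1] at this
    exact this.symm
  let f : LinearMap.ker q →ₗ[ℤ] expKernel R := (AddMonoidHom.mk' (fun z => ⟨_, hker z⟩)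
    fun _ _ => rfl).toIntLinearMap
  have hf : Function.Injective f := by
    intro y z hyz
    have h1 : (y : M).1.1 = (z : M).1.1 := congrArg Subtype.val hyz
    have hy : (y : M).1.2 = 0 := y.2
    have hz : (z : M).1.2 = 0 := z.2
    exact Subtype.ext (Subtype.ext (Prod.ext h1 (hy.trans hz.symm)))
  have hkfin : Module.Finite ℤ (LinearMap.ker q) := Module.Finite.of_injective f hf
  have hqfin : Module.Finite ℤ (M ⧸ LinearMap.ker q) :=
    Module.Finite.equiv q.quotKerEquivRange.symm
  have hMfin : Module.Finite ℤ M := Module.Finite.of_submodule_quotient (LinearMap.ker q)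
  rw [← hH]
  refine ⟨inferInstance, ?_⟩
  have h1 : Module.finrank ℤ (M.map (LinearMap.fst ℤ R (Fin p → ℤ))) ≤ Module.finrank ℤ M :=
    Submodule.finrank_map_le _ _
  have h2 := Submodule.finrank_quotient_add_finrank (LinearMap.ker q)
  have h3 := q.quotKerEquivRange.finrank_eq
  have h4 := Submodule.finrank_le (LinearMap.range q)
  rw [Module.finrank_fintype_fun_eq_card, Fintype.card_fin] at h4
  have h5 := LinearMap.finrank_le_finrank_of_injective hf
  omega

/-- In a commutative real algebra of dimension `n`, a group of units generated by at most
`(n + 1) / 2` elements is nowhere dense. -/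
theorem isNowhereDense_units_closure [Nontrivial R] {p : ℕ}
    (hp : p ≤ (Module.finrank ℝ R + 1) / 2) (g : Fin p → Rˣ) :
    IsNowhereDense (Units.val '' (Subgroup.closure (Set.range g) : Set Rˣ)) := by
  set G := Subgroup.closure (Set.range g) with hG
  let ψ : (Fin p → ℤ) →ₗ[ℤ] Additive Rˣ := Fintype.linearCombination ℤ fun i => Additive.ofMul (g i)
  have hψ : ∀ u, u ∈ G ↔ Additive.ofMul u ∈ LinearMap.range ψ := by
    intro u
    rw [Fintype.range_linearCombination, hG]
    have h := congrArg (fun K : AddSubgroup (Additive Rˣ) => Additive.ofMul u ∈ K)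
      (Submodule.span_int_eq_addSubgroupClosure (Set.range fun i => Additive.ofMul (g i)))
    refine Iff.trans ?_ (iff_of_eq h.symm)
    have h2 := congrArg (fun K => Additive.ofMul u ∈ K) (Subgroup.toAddSubgroup_closure (Set.range g))
    exact iff_of_eq h2
  set H := (LinearMap.range ψ).comap (expUnits R).toIntLinearMap with hHdef
  have hmem : ∀ x, x ∈ H ↔ NormedSpace.exp x ∈ Units.val '' (G : Set Rˣ) := by
    intro x
    have h1 : x ∈ H ↔ (expUnits R x).toMul ∈ G := (hψ _).symm
    rw [h1, ← coe_expUnits]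
    exact (Units.val_injective.mem_set_image).symm
  obtain ⟨hfin, hrank⟩ := finite_and_finrank_comap_expUnits_le ψ
  have hker := two_mul_finrank_expKernel_le (R := R)
  have hnd := isNowhereDense_of_finrank_int_le H (hrank.trans (by omega))
  rw [isNowhereDense_iff_forall_notMem_nhds] at hnd ⊢
  rintro _ ⟨u, hu, rfl⟩ hcl
  -- Translating by u⁻¹ moves the point to 1 = exp 0, as u itself need not be an exponential.
  have hcl1 : closure (Units.val '' (G : Set Rˣ)) ∈ nhds (1 : R) := by
    have hcont : Continuous fun y : R => (u : R) * y := by fun_prop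
    have h1 := hcont.continuousAt (x := 1)
    rw [ContinuousAt, mul_one] at h1
    filter_upwards [h1 hcl] with y hy
    have h2 : Set.MapsTo (fun y : R => ((u⁻¹ : Rˣ) : R) * y) (Units.val '' (G : Set Rˣ))
        (Units.val '' (G : Set Rˣ)) := by
      rintro _ ⟨w, hw, rfl⟩
      exact ⟨u⁻¹ * w, G.mul_mem (G.inv_mem hu) hw, by simp⟩
    have h3 := h2.closure (by fun_prop) hy
    simpa using h3
  refine hnd 0 H.zero_mem ?_
  have hpre : NormedSpace.exp ⁻¹' closure (Units.val '' (G : Set Rˣ)) ∈ nhds (0 : R) := by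
    rw [← Filter.mem_map, map_nhds_exp, NormedSpace.exp_zero]
    exact hcl1
  filter_upwards [hpre] with x hx
  have hx' := mem_closure_iff_frequently.mp hx
  rw [← map_nhds_exp, Filter.frequently_map] at hx'
  exact mem_closure_iff_frequently.mpr (hx'.mono fun y hy => (hmem y).mpr hy)
end

/-! ### Transfer to orbits -/

/-- In a commutative real algebra linearly isomorphic to `ℝ ^ n`, a group of units generated by at
most `(n + 1) / 2` elements is nowhere dense. -/
theorem isNowhereDense_image_units_closure {R : Type*} [NormedCommRing R] [NormedAlgebra ℝ R]
    [FiniteDimensional ℝ R] {n p : ℕ} (hn : 1 ≤ n) (hp : p ≤ (n + 1) / 2) (g : Fin p → Rˣ)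
    (e : R ≃ₗ[ℝ] (Fin n → ℝ)) :
    IsNowhereDense (e '' (Units.val '' (Subgroup.closure (Set.range g) : Set Rˣ))) := by
  have hdim : Module.finrank ℝ R = n := by rw [e.finrank_eq, Module.finrank_fin_fun]
  have : Nontrivial R := Module.nontrivial_of_finrank_pos (R := ℝ) (by omega)
  let : NormedAlgebra ℚ R := NormedAlgebra.restrictScalars ℚ ℝ R
  have : CompleteSpace R := FiniteDimensional.complete ℝ R
  exact e.toContinuousLinearEquiv.toHomeomorph.isInducing.isNowhereDense_image
    (isNowhereDense_units_closure (by rwa [hdim]) g)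

open scoped Matrix.Norms.Operator in
/-- The orbit of a vector under an abelian group of at most `(n + 1) / 2` generators is nowhere
dense. -/
theorem isNowhereDense_linearOrbit {n : ℕ} (hn : 1 ≤ n) {p : ℕ} (hp : p ≤ (n + 1) / 2)
    (A : Fin p → GL (Fin n) ℝ)
    (hG : ∀ B ∈ Subgroup.closure (Set.range A), ∀ C ∈ Subgroup.closure (Set.range A),
      B * C = C * B) (v : Fin n → ℝ) :
    IsNowhereDense (linearOrbit (Subgroup.closure (Set.range A)) v) := by
  set G := Subgroup.closure (Set.range A) with hGdef
  set S := Algebra.adjoin ℝ (Units.val '' (G : Set (GL (Fin n) ℝ))) with hS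
  have hcomm : IsMulCommutative S := Algebra.isMulCommutative_adjoin ℝ <| by
    rintro _ ⟨B, hB, rfl⟩ _ ⟨C, hC, rfl⟩
    exact congrArg Units.val (hG B hB C hC)
  have hGS : ∀ B ∈ G, (B : Matrix (Fin n) (Fin n) ℝ) ∈ S := fun B hB =>
    Algebra.subset_adjoin ⟨B, hB, rfl⟩
  let : NormedCommRing S :=
    { (inferInstance : NormedRing S) with mul_comm := fun a b => mul_comm' a b }
  let ev : S →ₗ[ℝ] (Fin n → ℝ) := (Matrix.mulVecBilin ℝ ℝ).flip v ∘ₗ S.val.toLinearMap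
  have hev : ∀ a : S, ev a = (a : Matrix (Fin n) (Fin n) ℝ) *ᵥ v := fun a => rfl
  have horb : linearOrbit G v ⊆ LinearMap.range ev := by
    rintro _ ⟨B, hB, rfl⟩
    exact ⟨⟨B, hGS B hB⟩, rfl⟩
  by_cases hsurj : LinearMap.range ev = ⊤
  -- If av = 0, then a(bv) = b(av) = 0 for all b in S, and the bv fill ℝⁿ.
  · have hinj : Function.Injective ev := by
      rw [injective_iff_map_eq_zero]
      intro a ha
      refine Subtype.ext (Matrix.ext_of_mulVec_single fun i => ?_)
      obtain ⟨b, hb⟩ := LinearMap.range_eq_top.mp hsurj (Pi.single i 1)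
      have hab : (a : Matrix (Fin n) (Fin n) ℝ) * b = b * a :=
        congrArg Subtype.val (mul_comm a b)
      rw [← hb, hev, Matrix.mulVec_mulVec, hab, ← Matrix.mulVec_mulVec, ← hev a, ha]
      simp
    let e : S ≃ₗ[ℝ] (Fin n → ℝ) :=
      LinearEquiv.ofBijective ev ⟨hinj, LinearMap.range_eq_top.mp hsurj⟩
    have hAG : ∀ i, A i ∈ G := fun i => Subgroup.subset_closure ⟨i, rfl⟩
    let g : Fin p → Sˣ := fun i =>
      ⟨⟨A i, hGS _ (hAG i)⟩, ⟨((A i)⁻¹ : GL (Fin n) ℝ), hGS _ (G.inv_mem (hAG i))⟩,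
        Subtype.ext (A i).mul_inv, Subtype.ext (A i).inv_mul⟩
    have hmap : (Subgroup.closure (Set.range g)).map (Units.map (S.val : S →* _)) = G := by
      rw [MonoidHom.map_closure, ← Set.range_comp, hGdef]
      congr 2
    refine (isNowhereDense_image_units_closure hn hp g e).mono ?_
    rintro _ ⟨B, hB, rfl⟩
    rw [← hmap] at hB
    obtain ⟨u, hu, rfl⟩ := hB
    exact ⟨_, ⟨u, hu, rfl⟩, rfl⟩
  · refine IsNowhereDense.mono horb ?_
    rw [(Submodule.closed_of_finiteDimensional _).isNowhereDense_iff]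
    by_contra h
    exact hsurj (Submodule.eq_top_of_nonempty_interior' _ (Set.nonempty_iff_ne_empty.mpr h))

theorem corollary1p7 (n : ℕ) (hn : 1 ≤ n) (G : Subgroup (GL (Fin n) ℝ))
    (hG : ∀ A ∈ G, ∀ B ∈ G, A * B = B * A)
    (p : ℕ) (hp : p ≤ (n + 1) / 2)
    (A : Fin p → GL (Fin n) ℝ) (hA : Subgroup.closure (Set.range A) = G) :
    (∀ v : Fin n → ℝ, IsNowhereDense (linearOrbit G v)) ∧ ¬ IsTopologicallyTransitiveGL G := by
  subst hA
  have h := isNowhereDense_linearOrbit hn hp A hG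
  refine ⟨h, ?_⟩
  rintro ⟨v, hv⟩
  have := h v
  rw [IsNowhereDense, hv.closure_eq, interior_univ] at this
  exact Set.univ_nonempty.ne_empty this
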